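/- Let $G=(U,V,E)$ be a finite bipartite graph with edge weights $w:E\to\mathbb{Q}$, $w_e>0$ for all $e\in E$. In the assignment game on $G$ the agents are the vertices $U\cup V$, and the worth $c(S)$ of a coalition $S\subseteq U\cup V$ is the maximum weight of a matching in the subgraph of $G$ induced on $S$. A core imputation is a function $p:U\cup V\to\mathbb{Q}_{\ge 0}$ with $\sum_{q\in U\cup V}p(q)=c(U\cup V)$ and $\sum_{q\in S}p(q)\ge c(S)$ for every $S\subseteq U\cup V$. An agent is essential if it is matched in every maximum weight matching of $G$. A leximin core imputation is a core imputation for which the list of the profits $p(q)$ of the essential agents $q$, sorted in increasing order, is lexicographically largest among all core imputations. If all edge weights are integers, then there is exactly one leximin core imputation $p$, and it is half-integral, i.e. $2p(q)\in\mathbb{Z}$ for every $q\in U\cup V$. -/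

import Mathlib

/-- The data of an assignment game: a finite bipartite graph with sides `U` and `V`, given by its
set of edges, with positive rational edge weights (values of `weight` off `edges` are never used). -/
structure AssignmentGame (U V : Type*) where
  edges : Finset (U × V)
  weight : U × V → ℚ
  weight_pos : ∀ e ∈ edges, 0 < weight e

namespace AssignmentGame

variable {U V : Type*}

/-- `M` is a matching of the graph: a set of edges no two of which share an endpoint. -/
def IsMatching (G : AssignmentGame U V) (M : Finset (U × V)) : Prop :=
  M ⊆ G.edges ∧ ∀ e ∈ M, ∀ f ∈ M, (e.1 = f.1 ∨ e.2 = f.2) → e = f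

/-- The total weight of a set of edges. -/
def totalWeight (G : AssignmentGame U V) (M : Finset (U × V)) : ℚ := ∑ e ∈ M, G.weight e

/-- A maximum weight matching of the whole graph. -/
def IsMaxMatching (G : AssignmentGame U V) (M : Finset (U × V)) : Prop :=
  G.IsMatching M ∧ ∀ M', G.IsMatching M' → G.totalWeight M' ≤ G.totalWeight M

open Classical in
/-- The matchings of the graph restricted to the vertices of the sub-coalition `S`. -/
noncomputable def matchingsIn (G : AssignmentGame U V) (S : Finset (U ⊕ V)) :
    Finset (Finset (U × V)) :=
  G.edges.powerset.filter fun M =>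
    G.IsMatching M ∧ ∀ e ∈ M, Sum.inl e.1 ∈ S ∧ Sum.inr e.2 ∈ S

open Classical in
theorem matchingsIn_nonempty (G : AssignmentGame U V) (S : Finset (U ⊕ V)) :
    (G.matchingsIn S).Nonempty :=
  ⟨∅, Finset.mem_filter.2 ⟨Finset.empty_mem_powerset _, by simp [IsMatching], by simp⟩⟩

/-- The characteristic function of the game: the worth of the sub-coalition `S` is the weight of
a maximum weight matching in the graph restricted to `S`. -/
noncomputable def worth (G : AssignmentGame U V) (S : Finset (U ⊕ V)) : ℚ :=
  (G.matchingsIn S).sup' (G.matchingsIn_nonempty S) G.totalWeight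

/-- An imputation: a nonnegative division of the worth of the grand coalition among all agents.
The profit of `i : U` is `p (Sum.inl i)`, that of `j : V` is `p (Sum.inr j)`. -/
def IsImputation [Fintype U] [Fintype V] (G : AssignmentGame U V) (p : U ⊕ V → ℚ) : Prop :=
  (∀ q, 0 ≤ p q) ∧ ∑ q, p q = G.worth Finset.univ

/-- A core imputation: every sub-coalition gets at least its own worth. -/
def IsCoreImputation [Fintype U] [Fintype V] (G : AssignmentGame U V) (p : U ⊕ V → ℚ) : Prop :=
  G.IsImputation p ∧ ∀ S : Finset (U ⊕ V), G.worth S ≤ ∑ q ∈ S, p q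

/-- The agent `q` is an endpoint of an edge of `M`. -/
def IsMatchedIn (M : Finset (U × V)) (q : U ⊕ V) : Prop :=
  ∃ e ∈ M, Sum.inl e.1 = q ∨ Sum.inr e.2 = q

/-- An essential agent: one that is matched in every maximum weight matching. -/
def IsEssential (G : AssignmentGame U V) (q : U ⊕ V) : Prop :=
  ∀ M, G.IsMaxMatching M → IsMatchedIn M q

open Classical in
/-- The set of essential agents of both sides. -/
noncomputable def essentialAgents [Fintype U] [Fintype V] (G : AssignmentGame U V) :
    Finset (U ⊕ V) :=
  Finset.univ.filter fun q => G.IsEssential q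

/-- The profits of the essential agents (with repetitions), sorted in increasing order. -/
noncomputable def sortedProfits [Fintype U] [Fintype V] (G : AssignmentGame U V)
    (p : U ⊕ V → ℚ) : List ℚ :=
  (G.essentialAgents.val.map p).sort (· ≤ ·)

/-- A leximin core imputation: a core imputation whose sorted list of profits of essential agents
is lexicographically largest. (The order on `List ℚ` is the lexicographic one, and all the lists
compared have the same length, the number of essential agents.) -/
def IsLeximin [Fintype U] [Fintype V] (G : AssignmentGame U V) (p : U ⊕ V → ℚ) : Prop :=
  G.IsCoreImputation p ∧
    ∀ p', G.IsCoreImputation p' → G.sortedProfits p' ≤ G.sortedProfits p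

end AssignmentGame

/-! By linear programming duality the core imputations are exactly the minimum fractional vertex
covers, so an agent with positive profit in some core imputation is essential. The core is nonempty
because an optimal integral dual solution satisfies Hall's condition on its tight edges: otherwise
shifting it by one on a deficient set would improve it.

If two core imputations `p`, `p'` differ, then at an agent where they differ and `min (p q) (p' q)`
is smallest, the midpoint strictly improves on the smaller of the two profits without bringing any
other changed profit down to that level. Hence there is at most one leximin core imputation.

Let `Γ` be a group containing the weights, and let `q₀` have the smallest profit among the agents
with `2 * p q ∉ Γ`. Raise by a small `ε` all profits congruent to `p q₀` modulo `Γ` on the side of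
`q₀`, and lower by `ε` all those congruent to `-p q₀` on the other side. On a tight edge the two
profits are opposite modulo `Γ`, so tight edges stay tight and the core is not left, while the
sorted list of profits increases. So `2 * p q ∈ Γ` for every leximin `p`.

Core imputations with profits in `ε ℤ` are finite in number, so one of them is best. The same
perturbation, applied with `Γ = 2 ε ℤ` in a finer lattice, shows that the best imputation of the
finer lattice already has its profits in `ε ℤ`; hence the best imputation of `ε ℤ` is leximin. -/

section LexSort

variable {α ι : Type*} [LinearOrder α]

theorem lt_of_coe_filter_le_lt {m : α} {l l' : List α} (hl : l.Pairwise (· ≤ ·))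
    (hl' : l'.Pairwise (· ≤ ·)) (hlen : l.length = l'.length)
    (h : (l'.filter (· ≤ m) : Multiset α) < l.filter (· ≤ m)) : l < l' := by
  induction l' generalizing l with
  | nil => simp_all [List.length_eq_zero_iff.1 hlen]
  | cons b t' ih =>
    obtain _ | ⟨a, t⟩ := l
    · simp at hlen
    rw [List.pairwise_cons] at hl hl'
    have head_le : ∀ x ∈ (a :: t).filter (· ≤ m), a ≤ x := fun x hx => by
      rcases List.mem_cons.1 (List.mem_of_mem_filter hx) with rfl | hxt
      exacts [le_rfl, hl.1 x hxt]
    by_cases hbm : b ≤ m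
    · have hab : a ≤ b := head_le b (Multiset.subset_of_le h.le (by simp [hbm]))
      rcases hab.lt_or_eq with hab | rfl
      · exact List.Lex.rel hab
      · refine List.Lex.cons (ih hl.2 hl'.2 (by simpa using hlen) ?_)
        simpa only [List.filter_cons, hbm, decide_true, if_true, ← Multiset.cons_coe,
          Multiset.cons_lt_cons_iff] using h
    · have hnil : (b :: t').filter (· ≤ m) = [] := by
        simp only [List.filter_eq_nil_iff, List.forall_mem_cons, decide_eq_true_eq]
        exact ⟨hbm, fun x hx hxm => hbm ((hl'.1 x hx).trans hxm)⟩
      obtain ⟨x, hx⟩ : ∃ x, x ∈ (a :: t).filter (· ≤ m) :=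
        List.exists_mem_of_ne_nil _ fun hnil' => by simp [hnil, hnil'] at h
      have hxm : x ≤ m := by simpa using List.of_mem_filter hx
      exact List.Lex.rel (((head_le x hx).trans hxm).trans_lt (not_le.1 hbm))

theorem sort_lt_sort_of_filter_le_lt {m : α} {s t : Multiset α} (hcard : s.card = t.card)
    (h : t.filter (· ≤ m) < s.filter (· ≤ m)) : s.sort (· ≤ ·) < t.sort (· ≤ ·) := by
  refine lt_of_coe_filter_le_lt (m := m) (Multiset.pairwise_sort _ _) (Multiset.pairwise_sort _ _)
    (by simpa using hcard) ?_
  rwa [← Multiset.filter_coe, ← Multiset.filter_coe, Multiset.sort_eq, Multiset.sort_eq]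

theorem sort_map_lt_sort_map {s : Multiset ι} {f g : ι → α} {m : α}
    (h : ∀ a ∈ s, g a ≤ m → f a = g a) (h' : ∃ a ∈ s, f a ≤ m ∧ m < g a) :
    (s.map f).sort (· ≤ ·) < (s.map g).sort (· ≤ ·) := by
  refine sort_lt_sort_of_filter_le_lt (m := m) (by simp) ?_
  have hle : s.filter (g · ≤ m) ≤ s.filter (f · ≤ m) :=
    Multiset.le_filter.2 ⟨Multiset.filter_le _ s, fun a ha => by
      obtain ⟨has, ham⟩ := Multiset.mem_filter.1 ha
      exact (h a has ham).trans_le ham⟩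
  have hne : s.filter (g · ≤ m) ≠ s.filter (f · ≤ m) := fun heq => by
    obtain ⟨a, has, hfa, hga⟩ := h'
    have ha : a ∈ s.filter (g · ≤ m) := heq ▸ Multiset.mem_filter.2 ⟨has, hfa⟩
    exact hga.not_ge (Multiset.mem_filter.1 ha).2
  have hmap : (s.filter (g · ≤ m)).map g = (s.filter (g · ≤ m)).map f :=
    Multiset.map_congr rfl fun a ha =>
      (h a (Multiset.mem_filter.1 ha).1 (Multiset.mem_filter.1 ha).2).symm
  simp only [Multiset.filter_map, Function.comp_def, hmap]
  exact Multiset.map_lt_map (hle.lt_of_ne hne)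

end LexSort

section Subgroup

open AddSubgroup (zmultiples mem_zmultiples_iff)

theorem exists_pos_forall_mem_zmultiples {ι : Type*} [Finite ι] (x : ι → ℚ) :
    ∃ ε : ℚ, 0 < ε ∧ ∀ i, x i ∈ zmultiples ε := by
  obtain ⟨b, hb⟩ := IsLocalization.exist_integer_multiples_of_finite (nonZeroDivisors ℤ) x
  have hb0 : (b : ℚ) ≠ 0 := Int.cast_ne_zero.2 (nonZeroDivisors.ne_zero b.2)
  refine ⟨|(b : ℚ)⁻¹|, abs_pos.2 (inv_ne_zero hb0), fun i => ?_⟩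
  obtain ⟨k, hk⟩ := hb i
  rw [zmultiples_abs]
  refine mem_zmultiples_iff.2 ⟨k, ?_⟩
  simp only [algebraMap_int_eq, eq_intCast, zsmul_eq_mul] at hk ⊢
  rw [hk, mul_comm, inv_mul_cancel_left₀ hb0]

theorem le_of_mem_zmultiples_of_pos {R : Type*} [AddCommGroup R] [LinearOrder R]
    [IsOrderedAddMonoid R] {ε x : R} (hε : 0 < ε) (hx : x ∈ zmultiples ε) (hx0 : 0 < x) :
    ε ≤ x := by
  obtain ⟨k, rfl⟩ := mem_zmultiples_iff.1 hx
  have hk : 0 < k := (zsmul_lt_zsmul_iff_left hε).1 (by simpa using hx0)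
  simpa using zsmul_le_zsmul_left hε.le (Int.add_one_le_of_lt hk)

theorem two_mul_mem_zmultiples_two_mul {R : Type*} [Ring R] [NoZeroDivisors R] [CharZero R]
    {ε x : R} : 2 * x ∈ zmultiples (2 * ε) ↔ x ∈ zmultiples ε := by
  simp only [mem_zmultiples_iff, ← mul_smul_comm, mul_right_inj' (two_ne_zero (α := R))]

theorem finite_Icc_inter_zmultiples {R : Type*} [AddCommGroup R] [LinearOrder R]
    [IsOrderedAddMonoid R] [Archimedean R] {ε : R} (hε : 0 < ε) (a b : R) :
    (Set.Icc a b ∩ zmultiples ε).Finite := by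
  obtain ⟨m, hm⟩ := Archimedean.arch (-a) hε
  obtain ⟨n, hn⟩ := Archimedean.arch b hε
  refine ((Set.finite_Icc (-m : ℤ) n).image (· • ε)).subset ?_
  rintro x ⟨⟨hax, hxb⟩, hx⟩
  obtain ⟨k, rfl⟩ := mem_zmultiples_iff.1 hx
  refine ⟨k, ⟨(zsmul_le_zsmul_iff_left hε).1 ?_, (zsmul_le_zsmul_iff_left hε).1 ?_⟩, rfl⟩
  · simpa using (neg_le.1 hm).trans hax
  · simpa using hxb.trans hn

theorem sub_mem_iff_add_mem_of_add_mem {A : Type*} [AddCommGroup A] {Γ : AddSubgroup A}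
    {a b c : A} (h : a + b ∈ Γ) : a - c ∈ Γ ↔ b + c ∈ Γ := by
  have hsum : a - c + (b + c) ∈ Γ := by rwa [sub_add_add_cancel]
  exact ⟨fun hac => (Γ.add_mem_cancel_left hac).1 hsum,
    fun hbc => (Γ.add_mem_cancel_right hbc).1 hsum⟩

end Subgroup

section Duality

/-- `u` and `v` form a feasible solution of the linear program dual to the assignment problem with
weight matrix `w`. -/
def IsDualFeasible {ι κ R : Type*} [Add R] [LE R] (w : ι → κ → R) (u : ι → R) (v : κ → R) : Prop :=
  ∀ i j, w i j ≤ u i + v j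

variable {ι : Type*}

theorem exists_isDualFeasible_forall_sum_le [Fintype ι] (w : ι → ι → ℤ) :
    ∃ u v, IsDualFeasible w u v ∧
      ∀ u' v', IsDualFeasible w u' v' → ∑ i, u i + ∑ j, v j ≤ ∑ i, u' i + ∑ j, v' j := by
  obtain ⟨_, ⟨u, v, huv, rfl⟩, hmin⟩ := Int.exists_least_of_bdd
    (P := fun z => ∃ u v, IsDualFeasible w u v ∧ ∑ i, u i + ∑ j, v j = z)
    ⟨∑ i, w i i, by
      rintro _ ⟨u, v, huv, rfl⟩
      rw [← Finset.sum_add_distrib]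
      exact Finset.sum_le_sum fun i _ => huv i i⟩
    ⟨_, fun i => ∑ j, |w i j|, 0, fun i j => by
      simpa using (le_abs_self _).trans
        (Finset.single_le_sum (fun j _ => abs_nonneg (w i j)) (Finset.mem_univ j)), rfl⟩
  exact ⟨u, v, huv, fun u' v' h => hmin _ ⟨u', v', h, rfl⟩⟩

theorem card_le_card_tight {κ : Type*} [Fintype ι] [Fintype κ] {w : ι → κ → ℤ} {u : ι → ℤ}
    {v : κ → ℤ} (huv : IsDualFeasible w u v)
    (hmin : ∀ u' v', IsDualFeasible w u' v' → ∑ i, u i + ∑ j, v j ≤ ∑ i, u' i + ∑ j, v' j)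
    (S : Finset ι) : S.card ≤ (Finset.univ.filter fun j => ∃ i ∈ S, u i + v j = w i j).card := by
  classical
  set T := Finset.univ.filter fun j => ∃ i ∈ S, u i + v j = w i j
  -- Lower `u` by one on `S` and raise `v` by one on its tight neighbourhood `T`.
  have hfeasible : IsDualFeasible w (fun i => u i - if i ∈ S then 1 else 0)
      (fun j => v j + if j ∈ T then 1 else 0) := fun i j => by
    have hij := huv i j
    have htight : i ∈ S → j ∉ T → u i + v j ≠ w i j := fun hi hj h =>
      hj (Finset.mem_filter.2 ⟨Finset.mem_univ j, i, hi, h⟩)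
    grind
  have hsum := hmin _ _ hfeasible
  simp only [Finset.sum_add_distrib, Finset.sum_sub_distrib, Finset.sum_boole,
    Finset.filter_mem_eq_inter, Finset.univ_inter] at hsum
  omega

theorem exists_isDualFeasible_perm_int [Finite ι] (w : ι → ι → ℤ) :
    ∃ (u v : ι → ℤ) (σ : Equiv.Perm ι), IsDualFeasible w u v ∧
      ∀ i, u i + v (σ i) = w i (σ i) := by
  classical
  cases nonempty_fintype ι
  obtain ⟨u, v, huv, hmin⟩ := exists_isDualFeasible_forall_sum_le w
  obtain ⟨f, hf, hfw⟩ := (Fintype.all_card_le_filter_rel_iff_exists_injective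
    fun i j => u i + v j = w i j).1 (card_le_card_tight huv hmin)
  exact ⟨u, v, Equiv.ofBijective f (Finite.injective_iff_bijective.1 hf), huv, hfw⟩

theorem exists_isDualFeasible_perm [Finite ι] (w : ι → ι → ℚ) :
    ∃ (u v : ι → ℚ) (σ : Equiv.Perm ι), IsDualFeasible w u v ∧
      ∀ i, u i + v (σ i) = w i (σ i) := by
  obtain ⟨ε, hε, hw⟩ := exists_pos_forall_mem_zmultiples fun x : ι × ι => w x.1 x.2
  choose k hk using fun i j => AddSubgroup.mem_zmultiples_iff.1 (hw (i, j))
  obtain ⟨u, v, σ, huv, hσ⟩ := exists_isDualFeasible_perm_int k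
  refine ⟨fun i => u i • ε, fun j => v j • ε, σ, fun i j => ?_, fun i => ?_⟩
  · rw [← hk, ← add_zsmul]
    exact zsmul_le_zsmul_left hε.le (huv i j)
  · rw [← hk, ← add_zsmul, hσ]

theorem IsDualFeasible.exists_nonneg_shift {κ R : Type*} [Finite ι] [Nonempty ι]
    [AddCommGroup R] [LinearOrder R] [IsOrderedAddMonoid R] {w : ι → κ → R} {u : ι → R} {v : κ → R}
    (huv : IsDualFeasible w u v) (hw : ∀ i j, 0 ≤ w i j) :
    ∃ c, (∀ i, 0 ≤ u i - c) ∧ ∀ j, 0 ≤ v j + c := by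
  obtain ⟨i₀, hi₀⟩ := Finite.exists_min u
  refine ⟨u i₀, fun i => sub_nonneg.2 (hi₀ i), fun j => ?_⟩
  rw [add_comm]
  exact (hw i₀ j).trans (huv i₀ j)

theorem exists_nonneg_isDualFeasible_perm [Finite ι] {w : ι → ι → ℚ} (hw : ∀ i j, 0 ≤ w i j) :
    ∃ (u v : ι → ℚ) (σ : Equiv.Perm ι), 0 ≤ u ∧ 0 ≤ v ∧ IsDualFeasible w u v ∧
      ∀ i, u i + v (σ i) = w i (σ i) := by
  obtain ⟨u, v, σ, huv, hσ⟩ := exists_isDualFeasible_perm w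
  cases isEmpty_or_nonempty ι
  · exact ⟨u, v, σ, isEmptyElim, isEmptyElim, huv, hσ⟩
  obtain ⟨c, hu, hv⟩ := huv.exists_nonneg_shift hw
  refine ⟨fun i => u i - c, fun j => v j + c, σ, hu, hv, fun i j => ?_, fun i => ?_⟩
  · simpa only [sub_add_add_cancel] using huv i j
  · simpa only [sub_add_add_cancel] using hσ i

end Duality

namespace AssignmentGame

open AddSubgroup (zmultiples)

variable {U V : Type*} {G : AssignmentGame U V} {M : Finset (U × V)} {S : Finset (U ⊕ V)}
  {p p' : U ⊕ V → ℚ}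

section Core

theorem totalWeight_le_worth (hM : G.IsMatching M)
    (hS : ∀ e ∈ M, Sum.inl e.1 ∈ S ∧ Sum.inr e.2 ∈ S) : G.totalWeight M ≤ G.worth S := by
  classical
  exact Finset.le_sup' G.totalWeight
    (Finset.mem_filter.2 ⟨Finset.mem_powerset.2 hM.1, hM, hS⟩)

theorem exists_totalWeight_eq_worth (G : AssignmentGame U V) (S : Finset (U ⊕ V)) :
    ∃ M, G.IsMatching M ∧ (∀ e ∈ M, Sum.inl e.1 ∈ S ∧ Sum.inr e.2 ∈ S) ∧
      G.totalWeight M = G.worth S := by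
  classical
  obtain ⟨M, hM, h⟩ := Finset.exists_mem_eq_sup' (G.matchingsIn_nonempty S) G.totalWeight
  exact ⟨M, (Finset.mem_filter.1 hM).2.1, (Finset.mem_filter.1 hM).2.2, h.symm⟩

theorem exists_isMaxMatching (G : AssignmentGame U V) : ∃ M, G.IsMaxMatching M := by
  classical
  obtain ⟨M, hM, hmax⟩ := Finset.exists_max_image (G.edges.powerset.filter G.IsMatching)
    G.totalWeight ⟨∅, by simp [IsMatching]⟩
  exact ⟨M, (Finset.mem_filter.1 hM).2, fun M' hM' =>
    hmax M' (Finset.mem_filter.2 ⟨Finset.mem_powerset.2 hM'.1, hM'⟩)⟩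

/-- `p` is a fractional vertex cover of the weighted graph: a feasible solution of the linear
program dual to maximum weight matching. -/
def IsCover (G : AssignmentGame U V) (p : U ⊕ V → ℚ) : Prop :=
  (∀ q, 0 ≤ p q) ∧ ∀ e ∈ G.edges, G.weight e ≤ p (.inl e.1) + p (.inr e.2)

/-- Complementary slackness between the profits `p` and the matching `M`. -/
def IsTightOn (G : AssignmentGame U V) (M : Finset (U × V)) (p : U ⊕ V → ℚ) : Prop :=
  (∀ e ∈ M, p (.inl e.1) + p (.inr e.2) = G.weight e) ∧ ∀ q, ¬ IsMatchedIn M q → p q = 0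

theorem mem_disjSum_image [DecidableEq U] [DecidableEq V] {q : U ⊕ V} :
    q ∈ (M.image Prod.fst).disjSum (M.image Prod.snd) ↔ IsMatchedIn M q := by
  rcases q with i | j <;> simp [IsMatchedIn]

theorem IsMatching.sum_disjSum_image [DecidableEq U] [DecidableEq V] (hM : G.IsMatching M)
    (p : U ⊕ V → ℚ) :
    ∑ q ∈ (M.image Prod.fst).disjSum (M.image Prod.snd), p q =
      ∑ e ∈ M, (p (.inl e.1) + p (.inr e.2)) := by
  rw [Finset.sum_disjSum, Finset.sum_image, Finset.sum_image, Finset.sum_add_distrib]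
  · exact fun e he f hf h => hM.2 e he f hf (.inr h)
  · exact fun e he f hf h => hM.2 e he f hf (.inl h)

theorem IsCover.worth_le_sum (hp : G.IsCover p) (S : Finset (U ⊕ V)) :
    G.worth S ≤ ∑ q ∈ S, p q := by
  classical
  obtain ⟨M, hM, hMS, hw⟩ := G.exists_totalWeight_eq_worth S
  calc G.worth S = ∑ e ∈ M, G.weight e := hw.symm
    _ ≤ ∑ e ∈ M, (p (.inl e.1) + p (.inr e.2)) := Finset.sum_le_sum fun e he => hp.2 e (hM.1 he)
    _ = ∑ q ∈ (M.image Prod.fst).disjSum (M.image Prod.snd), p q := (hM.sum_disjSum_image p).symm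
    _ ≤ ∑ q ∈ S, p q := by
      refine Finset.sum_le_sum_of_subset_of_nonneg (fun q hq => ?_) fun q _ _ => hp.1 q
      obtain ⟨e, he, rfl | rfl⟩ := mem_disjSum_image.1 hq
      exacts [(hMS e he).1, (hMS e he).2]

variable [Fintype U] [Fintype V]

theorem IsMaxMatching.totalWeight_eq_worth (hM : G.IsMaxMatching M) :
    G.totalWeight M = G.worth Finset.univ := by
  obtain ⟨M', hM', -, hw⟩ := G.exists_totalWeight_eq_worth Finset.univ
  exact le_antisymm (totalWeight_le_worth hM.1 (by simp)) (hw ▸ hM.2 M' hM')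

open Classical in
theorem IsMatching.sum_eq_add_sum_not_isMatchedIn (hM : G.IsMatching M) (p : U ⊕ V → ℚ) :
    ∑ q, p q = ∑ e ∈ M, (p (.inl e.1) + p (.inr e.2)) + ∑ q with ¬ IsMatchedIn M q, p q := by
  rw [← Finset.sum_filter_add_sum_filter_not Finset.univ (IsMatchedIn M), ← hM.sum_disjSum_image]
  congr 2
  ext q
  simp only [Finset.mem_filter_univ, mem_disjSum_image]

theorem IsCoreImputation.isCover (hp : G.IsCoreImputation p) : G.IsCover p := by
  classical
  refine ⟨hp.1.1, fun e he => ?_⟩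
  calc G.weight e = G.totalWeight {e} := (Finset.sum_singleton _ _).symm
    _ ≤ G.worth {.inl e.1, .inr e.2} :=
      totalWeight_le_worth ⟨by simpa using he, by simp⟩ (by simp)
    _ ≤ ∑ q ∈ {.inl e.1, .inr e.2}, p q := hp.2 _
    _ = p (.inl e.1) + p (.inr e.2) := Finset.sum_pair Sum.inl_ne_inr

theorem IsCover.isCoreImputation (hp : G.IsCover p) (hM : G.IsMatching M)
    (hMp : G.IsTightOn M p) : G.IsCoreImputation p := by
  classical
  refine ⟨⟨hp.1, le_antisymm ?_ (hp.worth_le_sum _)⟩, hp.worth_le_sum⟩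
  have hunmatched : ∑ q with ¬ IsMatchedIn M q, p q = 0 :=
    Finset.sum_eq_zero fun q hq => hMp.2 q (Finset.mem_filter.1 hq).2
  rw [hM.sum_eq_add_sum_not_isMatchedIn, Finset.sum_congr rfl hMp.1, hunmatched, add_zero]
  exact totalWeight_le_worth hM (by simp)

theorem IsCoreImputation.isTightOn (hp : G.IsCoreImputation p) (hM : G.IsMaxMatching M) :
    G.IsTightOn M p := by
  classical
  have hle : ∀ e ∈ M, G.weight e ≤ p (.inl e.1) + p (.inr e.2) :=
    fun e he => hp.isCover.2 e (hM.1.1 he)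
  have hedges : ∑ e ∈ M, G.weight e ≤ ∑ e ∈ M, (p (.inl e.1) + p (.inr e.2)) :=
    Finset.sum_le_sum hle
  have hrest : 0 ≤ ∑ q with ¬ IsMatchedIn M q, p q := Finset.sum_nonneg fun q _ => hp.1.1 q
  have htotal : ∑ e ∈ M, (p (.inl e.1) + p (.inr e.2)) + ∑ q with ¬ IsMatchedIn M q, p q =
      ∑ e ∈ M, G.weight e := by
    rw [← hM.1.sum_eq_add_sum_not_isMatchedIn, hp.1.2, ← hM.totalWeight_eq_worth, totalWeight]
  refine ⟨fun e he => ?_, fun q hq => ?_⟩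
  · exact ((Finset.sum_eq_sum_iff_of_le hle).1 (by linarith) e he).symm
  · exact (Finset.sum_eq_zero_iff_of_nonneg fun q _ => hp.1.1 q).1 (by linarith) q
      (by simpa using hq)

theorem IsCoreImputation.isEssential (hp : G.IsCoreImputation p) {q : U ⊕ V} (hq : p q ≠ 0) :
    G.IsEssential q :=
  fun _ hM => not_not.1 fun hqM => hq ((hp.isTightOn hM).2 q hqM)

theorem convex_setOf_isCoreImputation (G : AssignmentGame U V) :
    Convex ℚ {p | G.IsCoreImputation p} := by
  intro p hp p' hp' a b ha hb hab
  have hsum : ∀ S : Finset (U ⊕ V),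
      ∑ q ∈ S, (a • p + b • p') q = a * ∑ q ∈ S, p q + b * ∑ q ∈ S, p' q := fun S => by
    simp [Finset.sum_add_distrib, Finset.mul_sum]
  refine ⟨⟨fun q => ?_, ?_⟩, fun S => ?_⟩
  · exact add_nonneg (mul_nonneg ha (hp.1.1 q)) (mul_nonneg hb (hp'.1.1 q))
  · rw [hsum, hp.1.2, hp'.1.2, ← add_mul, hab, one_mul]
  · calc G.worth S = a * G.worth S + b * G.worth S := by rw [← add_mul, hab, one_mul]
      _ ≤ a * ∑ q ∈ S, p q + b * ∑ q ∈ S, p' q := by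
        gcongr
        exacts [hp.2 S, hp'.2 S]
      _ = ∑ q ∈ S, (a • p + b • p') q := (hsum S).symm

end Core

section CoreNonempty

/-- The weights of the game as a square matrix indexed by all agents, with zero entries wherever
there is no edge. -/
noncomputable def paddedWeight (G : AssignmentGame U V) : U ⊕ V → U ⊕ V → ℚ
  | .inl i, .inr j => (G.edges : Set (U × V)).indicator G.weight (i, j)
  | _, _ => 0

theorem paddedWeight_of_mem {e : U × V} (he : e ∈ G.edges) :
    G.paddedWeight (.inl e.1) (.inr e.2) = G.weight e :=
  Set.indicator_of_mem (Finset.mem_coe.2 he) _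

theorem paddedWeight_nonneg (a b : U ⊕ V) : 0 ≤ G.paddedWeight a b := by
  rcases a with _ | _ <;> rcases b with _ | _
  case inl.inr => exact Set.indicator_nonneg (fun e he => (G.weight_pos e he).le) _
  all_goals exact le_rfl

theorem exists_mem_edges_of_paddedWeight_ne_zero {a b : U ⊕ V} (h : G.paddedWeight a b ≠ 0) :
    ∃ e ∈ G.edges, .inl e.1 = a ∧ .inr e.2 = b := by
  rcases a with i | i <;> rcases b with j | j
  case inl.inr => exact ⟨(i, j), Set.mem_of_indicator_ne_zero h, rfl, rfl⟩
  all_goals exact absurd rfl h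

open Classical in
theorem isMatching_filter_perm (G : AssignmentGame U V) (σ : Equiv.Perm (U ⊕ V)) :
    G.IsMatching (G.edges.filter fun e => σ (.inl e.1) = .inr e.2) := by
  refine ⟨Finset.filter_subset _ _, fun e he f hf h => ?_⟩
  have hσe := (Finset.mem_filter.1 he).2
  have hσf := (Finset.mem_filter.1 hf).2
  rcases h with h | h
  · exact Prod.ext h (Sum.inr_injective (by rw [← hσe, ← hσf, h]))
  · exact Prod.ext (Sum.inl_injective (σ.injective (by rw [hσe, hσf, h]))) h

theorem exists_isCoreImputation [Fintype U] [Fintype V] (G : AssignmentGame U V) :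
    ∃ p, G.IsCoreImputation p := by
  classical
  obtain ⟨u, v, σ, hu, hv, huv, hσ⟩ :=
    exists_nonneg_isDualFeasible_perm (paddedWeight_nonneg (G := G))
  let p : U ⊕ V → ℚ := Sum.elim (fun i => u (.inl i)) fun j => v (.inr j)
  let M := G.edges.filter fun e => σ (.inl e.1) = .inr e.2
  have hcover : G.IsCover p :=
    ⟨Sum.rec (hu <| .inl ·) (hv <| .inr ·),
      fun e he => paddedWeight_of_mem he ▸ huv (.inl e.1) (.inr e.2)⟩
  have hunmatched : ∀ a, (∀ e ∈ M, ¬ (.inl e.1 = a ∧ .inr e.2 = σ a)) → u a = 0 ∧ v (σ a) = 0 := by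
    intro a ha
    rw [← add_eq_zero_iff_of_nonneg (hu a) (hv (σ a)), hσ]
    by_contra hne
    obtain ⟨e, he, rfl, hσe⟩ := exists_mem_edges_of_paddedWeight_ne_zero hne
    exact ha e (Finset.mem_filter.2 ⟨he, hσe.symm⟩) ⟨rfl, hσe⟩
  have htight : G.IsTightOn M p := by
    refine ⟨fun e he => ?_, ?_⟩
    · obtain ⟨he, hσe⟩ := Finset.mem_filter.1 he
      rw [← paddedWeight_of_mem he, ← hσe, ← hσ, hσe]
      rfl
    · rintro (i | j) hq
      · exact (hunmatched (.inl i) fun e he h => hq ⟨e, he, .inl h.1⟩).1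
      · obtain ⟨a, ha⟩ := σ.surjective (.inr j)
        have hva := (hunmatched a fun e he h => hq ⟨e, he, .inr (h.2.trans ha)⟩).2
        rwa [ha] at hva
  exact ⟨p, hcover.isCoreImputation (G.isMatching_filter_perm σ) htight⟩

end CoreNonempty

section Raise

open Classical in
/-- The perturbation of `p` that raises by `ε` the profits congruent to `p q₀` modulo `Γ` on the
side of `q₀` and lowers by `ε` those congruent to `-p q₀` on the other side. -/
noncomputable def raise (Γ : AddSubgroup ℚ) (ε : ℚ) (q₀ : U ⊕ V) (p : U ⊕ V → ℚ) (q : U ⊕ V) : ℚ :=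
  if q.isLeft = q₀.isLeft then (if p q - p q₀ ∈ Γ then p q + ε else p q)
  else (if p q + p q₀ ∈ Γ then p q - ε else p q)

variable {Γ : AddSubgroup ℚ} {ε : ℚ} {q₀ q : U ⊕ V}

theorem raise_self : raise Γ ε q₀ p q₀ = p q₀ + ε := by
  simp [raise, Γ.zero_mem]

theorem raise_eq_or : raise Γ ε q₀ p q = p q ∨ raise Γ ε q₀ p q = p q + ε ∨
    (raise Γ ε q₀ p q = p q - ε ∧ p q + p q₀ ∈ Γ) := by
  unfold raise
  split_ifs <;> simp [*]

theorem raise_of_two_mul_mem (hq₀ : 2 * p q₀ ∉ Γ) (hq : 2 * p q ∈ Γ) :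
    raise Γ ε q₀ p q = p q := by
  have hsub : p q - p q₀ ∉ Γ := fun h => hq₀ <| by
    rw [show 2 * p q₀ = 2 * p q - ((p q - p q₀) + (p q - p q₀)) by ring]
    exact Γ.sub_mem hq (Γ.add_mem h h)
  have hadd : p q + p q₀ ∉ Γ := fun h => hq₀ <| by
    rw [show 2 * p q₀ = (p q + p q₀) + (p q + p q₀) - 2 * p q by ring]
    exact Γ.sub_mem (Γ.add_mem h h) hq
  simp only [raise, hsub, hadd, if_false, ite_self]

theorem raise_add_raise_of_mem {i : U} {j : V} (h : p (.inl i) + p (.inr j) ∈ Γ) :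
    raise Γ ε q₀ p (.inl i) + raise Γ ε q₀ p (.inr j) = p (.inl i) + p (.inr j) := by
  have hinl := sub_mem_iff_add_mem_of_add_mem (c := p q₀) h
  have hinr := sub_mem_iff_add_mem_of_add_mem (c := p q₀) (add_comm (p (.inl i)) _ ▸ h)
  rcases q₀ <;>
    simp only [raise, Sum.isLeft_inl, Sum.isLeft_inr, reduceCtorEq, if_true, if_false] <;>
    split_ifs <;> grind

theorem sub_le_raise_add_raise (hε : 0 ≤ ε) (i : U) (j : V) :
    p (.inl i) + p (.inr j) - ε ≤ raise Γ ε q₀ p (.inl i) + raise Γ ε q₀ p (.inr j) := by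
  rcases q₀ <;>
    simp only [raise, Sum.isLeft_inl, Sum.isLeft_inr, reduceCtorEq, if_true, if_false] <;>
    split_ifs <;> linarith

theorem raise_eq_of_raise_le (hε : 0 < ε) (hΓε : Γ ≤ zmultiples (2 * ε))
    (hp : ∀ q, p q ∈ zmultiples ε) (hq₀ : 2 * p q₀ ∉ Γ)
    (hmin : ∀ q, 2 * p q ∉ Γ → p q₀ ≤ p q) (hle : raise Γ ε q₀ p q ≤ p q₀) :
    raise Γ ε q₀ p q = p q := by
  by_contra hne
  have hq : p q₀ ≤ p q := hmin q fun h => hne (raise_of_two_mul_mem hq₀ h)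
  obtain h | h | ⟨h, hadd⟩ := raise_eq_or (Γ := Γ) (ε := ε) (q₀ := q₀) (p := p) (q := q)
  · exact hne h
  · linarith
  · have hlt : p q₀ < p q := hq.lt_of_ne fun heq =>
      hq₀ (by simpa only [two_mul, heq] using hadd)
    -- Both `p q + p q₀` and `2 * p q₀` are multiples of `2 * ε`, so the gap is at least `2 * ε`.
    have hgap : p q - p q₀ ∈ zmultiples (2 * ε) := by
      rw [show p q - p q₀ = p q + p q₀ - 2 * p q₀ by ring]
      exact sub_mem (hΓε hadd) (two_mul_mem_zmultiples_two_mul.2 (hp q₀))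
    linarith [le_of_mem_zmultiples_of_pos (by linarith) hgap (sub_pos.2 hlt)]

theorem isTightOn_raise (hM : M ⊆ G.edges) (hΓ : ∀ e ∈ G.edges, G.weight e ∈ Γ)
    (hq₀ : 2 * p q₀ ∉ Γ) (hp : G.IsTightOn M p) : G.IsTightOn M (raise Γ ε q₀ p) := by
  refine ⟨fun e he => ?_, fun q hq => ?_⟩
  · rw [raise_add_raise_of_mem (hp.1 e he ▸ hΓ e (hM he)), hp.1 e he]
  · rw [raise_of_two_mul_mem hq₀ (by simp [hp.2 q hq]), hp.2 q hq]

end Raise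

section Lattice

/-- The core imputations all of whose profits are integer multiples of `ε`. -/
def latticeCore [Fintype U] [Fintype V] (G : AssignmentGame U V) (ε : ℚ) : Set (U ⊕ V → ℚ) :=
  {p | G.IsCoreImputation p ∧ ∀ q, p q ∈ zmultiples ε}

variable [Fintype U] [Fintype V] {Γ : AddSubgroup ℚ} {ε : ℚ} {q₀ : U ⊕ V}

theorem finite_latticeCore (hε : 0 < ε) : (G.latticeCore ε).Finite := by
  refine (Set.Finite.pi' fun _ : U ⊕ V =>
    finite_Icc_inter_zmultiples hε 0 (G.worth Finset.univ)).subset fun p hp q => ?_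
  have hq : p q ≤ G.worth Finset.univ :=
    hp.1.1.2 ▸ Finset.single_le_sum (fun q _ => hp.1.1.1 q) (Finset.mem_univ q)
  exact ⟨⟨hp.1.1.1 q, hq⟩, hp.2 q⟩

theorem isCover_raise (hε : 0 < ε) (hΓ : ∀ e ∈ G.edges, G.weight e ∈ Γ)
    (hΓε : Γ ≤ zmultiples ε) (hq₀ : 2 * p q₀ ∉ Γ) (hp : p ∈ G.latticeCore ε) :
    G.IsCover (raise Γ ε q₀ p) := by
  refine ⟨fun q => ?_, fun e he => ?_⟩
  · obtain hq | hq := (hp.1.1.1 q).eq_or_lt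
    · rw [raise_of_two_mul_mem hq₀ (by simp [← hq]), ← hq]
    · have hεq := le_of_mem_zmultiples_of_pos hε (hp.2 q) hq
      obtain h | h | ⟨h, -⟩ := raise_eq_or (Γ := Γ) (ε := ε) (q₀ := q₀) (p := p) (q := q) <;>
        linarith
  · obtain he' | he' := (hp.1.isCover.2 e he).eq_or_lt
    · rw [raise_add_raise_of_mem (he' ▸ hΓ e he), ← he']
    · have hslack : p (.inl e.1) + p (.inr e.2) - G.weight e ∈ zmultiples ε :=
        sub_mem (add_mem (hp.2 _) (hp.2 _)) (hΓε (hΓ e he))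
      linarith [le_of_mem_zmultiples_of_pos hε hslack (sub_pos.2 he'),
        sub_le_raise_add_raise (Γ := Γ) (q₀ := q₀) (p := p) hε.le e.1 e.2]

theorem raise_mem_latticeCore (hε : 0 < ε) (hΓ : ∀ e ∈ G.edges, G.weight e ∈ Γ)
    (hΓε : Γ ≤ zmultiples ε) (hq₀ : 2 * p q₀ ∉ Γ) (hp : p ∈ G.latticeCore ε) :
    raise Γ ε q₀ p ∈ G.latticeCore ε := by
  obtain ⟨M, hM⟩ := G.exists_isMaxMatching
  refine ⟨(isCover_raise hε hΓ hΓε hq₀ hp).isCoreImputation hM.1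
    (isTightOn_raise hM.1.1 hΓ hq₀ (hp.1.isTightOn hM)), fun q => ?_⟩
  have hmem : ε ∈ zmultiples ε := AddSubgroup.mem_zmultiples ε
  obtain h | h | ⟨h, -⟩ := raise_eq_or (Γ := Γ) (ε := ε) (q₀ := q₀) (p := p) (q := q) <;> rw [h]
  exacts [hp.2 q, add_mem (hp.2 q) hmem, sub_mem (hp.2 q) hmem]

end Lattice

section Leximin

variable [Fintype U] [Fintype V] {Γ : AddSubgroup ℚ} {ε : ℚ}

theorem sortedProfits_lt_sortedProfits {q₀ : U ⊕ V} (hq₀ : G.IsEssential q₀) (hlt : p q₀ < p' q₀)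
    (h : ∀ q, p' q ≤ p q₀ → p' q = p q) : G.sortedProfits p < G.sortedProfits p' := by
  classical
  exact sort_map_lt_sort_map (fun q _ hq => (h q hq).symm)
    ⟨q₀, Finset.mem_filter.2 ⟨Finset.mem_univ _, hq₀⟩, le_rfl, hlt⟩

theorem exists_sortedProfits_lt (hε : 0 < ε) (hΓ : ∀ e ∈ G.edges, G.weight e ∈ Γ)
    (hΓε : Γ ≤ zmultiples (2 * ε)) (hp : p ∈ G.latticeCore ε) {q : U ⊕ V} (hq : 2 * p q ∉ Γ) :
    ∃ p' ∈ G.latticeCore ε, G.sortedProfits p < G.sortedProfits p' := by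
  obtain ⟨q₀, hq₀, hmin⟩ := Set.exists_min_image {q | 2 * p q ∉ Γ} p (Set.toFinite _) ⟨q, hq⟩
  have hΓε' : Γ ≤ zmultiples ε := hΓε.trans <| by
    rw [AddSubgroup.zmultiples_le]
    exact AddSubgroup.intCast_mul_mem_zmultiples (k := 2) ε
  have hq₀0 : p q₀ ≠ 0 := fun h => hq₀ (by simp [h])
  refine ⟨raise Γ ε q₀ p, raise_mem_latticeCore hε hΓ hΓε' hq₀ hp,
    sortedProfits_lt_sortedProfits (hp.1.isEssential hq₀0)
      (by simpa only [raise_self, lt_add_iff_pos_right] using hε)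
      fun q => raise_eq_of_raise_le hε hΓε hp.2 hq₀ hmin⟩

theorem two_mul_mem_of_isMaxOn (hε : 0 < ε) (hΓ : ∀ e ∈ G.edges, G.weight e ∈ Γ)
    (hGε : ∀ e ∈ G.edges, G.weight e ∈ zmultiples (2 * ε)) (hp : p ∈ G.latticeCore ε)
    (hmax : IsMaxOn G.sortedProfits (G.latticeCore ε) p) (q : U ⊕ V) : 2 * p q ∈ Γ := by
  by_contra hq
  obtain ⟨p', hp', hlt⟩ := exists_sortedProfits_lt (Γ := Γ ⊓ zmultiples (2 * ε)) hε
    (fun e he => ⟨hΓ e he, hGε e he⟩) inf_le_right hp fun h => hq h.1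
  exact hlt.not_ge (hmax hp')

theorem exists_pos_mem_latticeCore (hp : G.IsCoreImputation p) :
    ∃ ε, 0 < ε ∧ p ∈ G.latticeCore ε ∧ ∀ e ∈ G.edges, G.weight e ∈ zmultiples (2 * ε) := by
  obtain ⟨ε, hε, h⟩ := exists_pos_forall_mem_zmultiples
    (Sum.elim p fun e : U × V => G.weight e / 2)
  refine ⟨ε, hε, ⟨hp, fun q => h (.inl q)⟩, fun e _ => ?_⟩
  rw [← mul_div_cancel₀ (G.weight e) two_ne_zero]
  exact two_mul_mem_zmultiples_two_mul.2 (h (.inr e))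

theorem IsLeximin.two_mul_mem (hp : G.IsLeximin p) (hΓ : ∀ e ∈ G.edges, G.weight e ∈ Γ)
    (q : U ⊕ V) : 2 * p q ∈ Γ := by
  obtain ⟨ε, hε, hpε, hGε⟩ := exists_pos_mem_latticeCore hp.1
  exact two_mul_mem_of_isMaxOn hε hΓ hGε hpε (fun p' hp' => hp.2 p' hp'.1) q

theorem IsCoreImputation.exists_mem_latticeCore_sortedProfits_le (hp : G.IsCoreImputation p)
    (hGε : ∀ e ∈ G.edges, G.weight e ∈ zmultiples (2 * ε)) :
    ∃ p' ∈ G.latticeCore ε, G.sortedProfits p ≤ G.sortedProfits p' := by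
  obtain ⟨δ, hδ, hpδ, hGδ⟩ := exists_pos_mem_latticeCore hp
  obtain ⟨p', hp', hmax⟩ := Set.exists_max_image _ G.sortedProfits (finite_latticeCore hδ) ⟨p, hpδ⟩
  exact ⟨p', ⟨hp'.1, fun q => two_mul_mem_zmultiples_two_mul.1
    (two_mul_mem_of_isMaxOn hδ hGε hGδ hp' hmax q)⟩, hmax p hpδ⟩

theorem exists_isLeximin (G : AssignmentGame U V) : ∃ p, G.IsLeximin p := by
  obtain ⟨p₀, hp₀⟩ := G.exists_isCoreImputation
  obtain ⟨ε, hε, hp₀ε, hGε⟩ := exists_pos_mem_latticeCore hp₀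
  obtain ⟨p, hp, hmax⟩ := Set.exists_max_image _ G.sortedProfits (finite_latticeCore hε) ⟨p₀, hp₀ε⟩
  refine ⟨p, hp.1, fun p' hp' => ?_⟩
  obtain ⟨p'', hp'', hle⟩ := hp'.exists_mem_latticeCore_sortedProfits_le hGε
  exact hle.trans (hmax p'' hp'')

theorem min_sortedProfits_lt_sortedProfits_midpoint (hp : G.IsCoreImputation p)
    (hp' : G.IsCoreImputation p') (hne : p ≠ p') :
    min (G.sortedProfits p) (G.sortedProfits p') < G.sortedProfits (midpoint ℚ p p') := by
  obtain ⟨q₀, hq₀, hmin⟩ := Set.exists_min_image {q | p q ≠ p' q} (fun q => min (p q) (p' q))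
    (Set.toFinite _) (Function.ne_iff.1 hne)
  wlog hlt : p q₀ < p' q₀ generalizing p p'
  · rw [min_comm, midpoint_comm]
    refine this hp' hp hne.symm (Ne.symm hq₀) (fun q hq => ?_) (hq₀.lt_or_gt.resolve_left hlt)
    simpa only [min_comm] using hmin q (Ne.symm hq)
  have hq₀0 : p' q₀ ≠ 0 := ((hp.1.1 q₀).trans_lt hlt).ne'
  refine min_lt_of_left_lt (sortedProfits_lt_sortedProfits (hp'.isEssential hq₀0) ?_ fun q hq => ?_)
  · rw [pi_midpoint_apply]
    exact not_le.1 fun h => hlt.not_ge (midpoint_le_left.1 h)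
  · rw [pi_midpoint_apply] at hq ⊢
    have heq : p q = p' q := by
      by_contra hpq
      obtain ⟨hle, hle'⟩ : p q₀ ≤ p q ∧ p q₀ ≤ p' q := by
        simpa only [min_eq_left hlt.le, le_min_iff] using hmin q hpq
      exact hpq ((midpoint_le_right.1 (hq.trans hle')).antisymm
        (midpoint_le_left.1 (hq.trans hle)))
    rw [← heq, midpoint_self]

theorem IsLeximin.eq (hp : G.IsLeximin p) (hp' : G.IsLeximin p') : p = p' := by
  by_contra hne
  have hmid : G.IsCoreImputation (midpoint ℚ p p') :=
    G.convex_setOf_isCoreImputation.midpoint_mem hp.1 hp'.1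
  exact (min_sortedProfits_lt_sortedProfits_midpoint hp.1 hp'.1 hne).not_ge
    (le_min (hp.2 _ hmid) (hp'.2 _ hmid))

theorem existsUnique_isLeximin (G : AssignmentGame U V) : ∃! p, G.IsLeximin p := by
  obtain ⟨p, hp⟩ := G.exists_isLeximin
  exact ⟨p, hp, fun p' hp' => hp'.eq hp⟩

end Leximin

end AssignmentGame

theorem mainTheorem6_general {U V : Type*} [Fintype U] [Fintype V] (G : AssignmentGame U V) :
    (∃! p : U ⊕ V → ℚ, G.IsLeximin p) ∧
      ∀ Γ : AddSubgroup ℚ, (∀ e ∈ G.edges, G.weight e ∈ Γ) →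
        ∀ p : U ⊕ V → ℚ, G.IsLeximin p → ∀ q, 2 * p q ∈ Γ :=
  ⟨G.existsUnique_isLeximin, fun _ hΓ _ hp q => hp.two_mul_mem hΓ q⟩

theorem mainTheorem6 {U V : Type*} [Fintype U] [Fintype V] (G : AssignmentGame U V)
    (hint : ∀ e ∈ G.edges, ∃ k : ℤ, G.weight e = k) :
    (∃! p : U ⊕ V → ℚ, G.IsLeximin p) ∧
      ∀ p : U ⊕ V → ℚ, G.IsLeximin p → ∀ q, ∃ k : ℤ, p q = (k : ℚ) / 2 := by
  obtain ⟨hunique, hmem⟩ := mainTheorem6_general G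
  refine ⟨hunique, fun p hp q => ?_⟩
  obtain ⟨k, hk⟩ := hmem (Int.castAddHom ℚ).range
    (fun e he => (hint e he).imp fun _ => Eq.symm) p hp q
  exact ⟨k, eq_div_of_mul_eq two_ne_zero ((mul_comm _ _).trans hk.symm)⟩
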